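/- Let $\Lambda\subset\mathbb R^n$ be convex and compact, let $\Omega\subset\Lambda$ be a non-empty open subset of $\mathbb R^n$, and put $K=\Lambda\setminus\Omega$. Let $f:\Lambda\to\mathbb R$ be bounded and uniformly continuous, with $|f(x)|\le A_0$ for all $x\in K$, where $A_0>0$. Let $\tilde f:\mathbb R^n\to\mathbb R$ be a bounded, uniformly continuous extension of $f$ such that $\tilde f(x)=c_0$ for $x\notin B(0;r)$, where $r>0$ and $K\subset B(0;r)$ (open ball). For $R>r$ put $K_R=K\cup B(0;R)^c$, and let $f_{K_R}=f$ on $K$ and $f_{K_R}=c_0$ on $B(0;R)^c$. Notation. For a set $S\subset\mathbb R^n$, $g:S\to\mathbb R$ bounded, $\lambda>0$ and $M>0$, let $g^{\pm M}:\mathbb R^n\to\mathbb R$ equal $g$ on $S$ and $\pm M$ off $S$, and $$A^M_\lambda(g)(x)=\tfrac12\Big(\big(\mathrm{co}[\lambda|\cdot|^2+g^{M}](x)-\lambda|x|^2\big)+\big(\lambda|x|^2-\mathrm{co}[\lambda|\cdot|^2-g^{-M}](x)\big)\Big),$$ where $\mathrm{co}[h]$ is the convex envelope (largest convex minorant) of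 $h$ when it stands before a function, and $\mathrm{co}[K]$ is the convex hull of the set $K$. For $x\in\mathrm{co}[K]$ let $r_c(x)=\inf\{\rho\ge0:\ x\in\mathrm{co}[\bar B(x;\rho)\cap K]\}$. Let $f_K=f|_K$, and let $\omega$ be the least concave majorant on $[0,\infty)$ of the modulus of continuity $t\mapsto\sup\{|\tilde f(x)-\tilde f(y)|:|x-y|\le t\}$ of $\tilde f$. (i) Let $a,b\ge0$ satisfy $\omega(t)\le at+b$ for all $t\ge0$. Then for all $\lambda>0$, $M>A_0+\lambda(R+r)^2$ and $x\in\mathrm{co}[K]$, $$|A^M_\lambda(f_K)(x)-\tilde f(x)|\le\omega\Big(r_c(x)+\frac a\lambda+\sqrt{\frac{2b}\lambda}\Big),$$ and the same estimate holds with $A^M_\lambda(f_{K_R})$ in place of $A^M_\lambda(f_K)$. (ii) If $\tilde f$ is Lipschitz on $\mathbb R^n$ with constant $L>0$, then for all $\lambda>0$, $M>A_0+\lambda(R+r)^2$ and $x\in\mathrm{co}[K]$, $$|A^M_\lambda(f_{K_R})(x)-f(x)|\le L\,r_c(x)+\frac{L^2}\lambda .$$ (iii) If $\tilde f$ is $C^{1,1}$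 with $|D\tilde f(x)-D\tilde f(y)|\le L|x-y|$ for all $x,y\in\mathbb R^n$, where $L>0$, then for all $\lambda>L$, $M>A_0+\lambda(R+r)^2$ and $x\in\mathrm{co}[K]$, $$|A^M_\lambda(f_{K_R})(x)-\tilde f(x)|\le\frac L4\left(\frac{\lambda+L/2}{\lambda-L/2}+1\right)r_c(x)^2 ,$$ and $A^M_\lambda(f_{K_R})(x)=f(x)$ for all $x\in K$, i.e. $A^M_\lambda(f_{K_R})$ interpolates $f_K$. -/

import Mathlib

namespace CompensatedConvex

noncomputable section

/-- The convex envelope `co[g]`: the largest convex function on `ℝⁿ` below `g`, as the pointwise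
supremum of all convex minorants (a real number at every point when `g` is bounded below). -/
def convexEnvelope {n : ℕ} (g : EuclideanSpace ℝ (Fin n) → ℝ)
    (x : EuclideanSpace ℝ (Fin n)) : ℝ :=
  sSup {v : ℝ | ∃ h : EuclideanSpace ℝ (Fin n) → ℝ,
    ConvexOn ℝ Set.univ h ∧ (∀ y, h y ≤ g y) ∧ v = h x}

/-- The quadratic lower compensated convex transform `C^l_lam(f)`. -/
def lowerTransform {n : ℕ} (lam : ℝ) (f : EuclideanSpace ℝ (Fin n) → ℝ)
    (x : EuclideanSpace ℝ (Fin n)) : ℝ :=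
  convexEnvelope (fun y => lam * ‖y‖ ^ 2 + f y) x - lam * ‖x‖ ^ 2

/-- The quadratic upper compensated convex transform `C^u_lam(f)`. -/
def upperTransform {n : ℕ} (lam : ℝ) (f : EuclideanSpace ℝ (Fin n) → ℝ)
    (x : EuclideanSpace ℝ (Fin n)) : ℝ :=
  lam * ‖x‖ ^ 2 - convexEnvelope (fun y => lam * ‖y‖ ^ 2 - f y) x

open Classical in
/-- The function equal to `f` on the sample set `S` and to the constant `c` off `S`.
Only the values of `f` on `S` matter. -/
def extendConst {n : ℕ} (S : Set (EuclideanSpace ℝ (Fin n)))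
    (f : EuclideanSpace ℝ (Fin n) → ℝ) (c : ℝ) (x : EuclideanSpace ℝ (Fin n)) : ℝ :=
  if x ∈ S then f x else c

/-- The average compensated convex approximation `A^M_lam(f_S)`, with scale `lam` and module `M`,
of the sampled function `f_S`, the restriction of `f` to `S`. -/
def averageApprox {n : ℕ} (lam M : ℝ) (S : Set (EuclideanSpace ℝ (Fin n)))
    (f : EuclideanSpace ℝ (Fin n) → ℝ) (x : EuclideanSpace ℝ (Fin n)) : ℝ :=
  (1 / 2) * (lowerTransform lam (extendConst S f M) x
    + upperTransform lam (extendConst S f (-M)) x)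

/-- The modulus of continuity `ω_f(t) = sup {|f x - f y| : |x - y| ≤ t}` of a bounded function
on `ℝⁿ`. -/
def modulusOfContinuity {n : ℕ} (f : EuclideanSpace ℝ (Fin n) → ℝ) (t : ℝ) : ℝ :=
  sSup {v : ℝ | ∃ x y : EuclideanSpace ℝ (Fin n), ‖x - y‖ ≤ t ∧ v = |f x - f y|}

/-- The least concave majorant on `[0, ∞)` of a function `w`: the pointwise infimum of all
functions that are concave on `[0, ∞)` and bound `w` from above there. -/
def leastConcaveMajorant (w : ℝ → ℝ) (t : ℝ) : ℝ :=
  sInf {v : ℝ | ∃ g : ℝ → ℝ,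
    ConcaveOn ℝ (Set.Ici 0) g ∧ (∀ s, 0 ≤ s → w s ≤ g s) ∧ v = g t}

/-- The convex density radius `r_c(x)` of a point `x` with respect to the set `K`. -/
def convexDensityRadius {n : ℕ} (K : Set (EuclideanSpace ℝ (Fin n)))
    (x : EuclideanSpace ℝ (Fin n)) : ℝ :=
  sInf {r : ℝ | 0 ≤ r ∧ x ∈ convexHull ℝ (Metric.closedBall x r ∩ K)}

end

end CompensatedConvex

/-!
The lower transform at `x` is the infimum of `∑ wᵢ (lam ‖yᵢ - x‖² + g yᵢ)` over convex
combinations `x = ∑ wᵢ yᵢ`, because the convex envelope is the lower boundary of the convex hull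
of the graph. So every convex combination bounds the lower transform from above and the upper
transform from below, and near-optimal ones exist. Replacing `F` by `-F` exchanges the two
transforms, so it suffices to bound `F x - averageApprox` from above. Take a near-optimal
combination for the lower transform and use the same points as a competitor for the upper
transform; in the sum the quadratic terms can be discarded, and what remains is controlled by the mean
distance `s = ∑ wᵢ ‖yᵢ - x‖` through Jensen's inequality for the concave modulus `ω`. Comparing
the near-optimal combination with one from `closedBall x ρ ∩ K`, where `ρ` is close to the convex
density radius, gives `lam s² ≤ ω s + ω ρ + lam ρ²`, hence a bound on `s`
(`exists_sub_averageApprox_le`, `sub_averageApprox_le_modulus`).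

The module `M` enters as follows. Points of `Om` are unnecessary in the combinations, as they are
convex combinations of sample points with smaller values. Points outside `Lam` that are not
sampled may well occur. Each is pulled back along the segment to `x` to a point of `Lam \ Om`,
where `F ≤ M`; when `x ∈ Om`, reweighting by the inverse factors keeps the barycentre and does
not increase the first two moments (`IsConvexComb.exists_pull`), and when `x ∉ Om` the point `x`
is itself a sample point. This argument needs nothing about the size of `c₀`.

In the `C^{1,1}` case the modulus is replaced by the Taylor expansion at `x`, whose linear term
averages out. Here the derivative vanishes off a ball, which bounds `c₀`, so that the sphere of
radius `R` makes all points off the sample set unnecessary. The resulting bound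
`L / 2 * ρ ^ 2`, with `ρ` the convex density radius, implies the stated one because
`(lam + L / 2) / (lam - L / 2) ≥ 1`; as `ρ = 0` on `K`, it also gives the interpolation
(`sub_averageApprox_le_of_lipschitz_fderiv`).
-/

namespace CompensatedConvex

/-! ### Convex combinations and the convex envelope -/

/-- The point `x` is the convex combination of the finitely many points `y i` with weights `w i`. -/
structure IsConvexComb {n : ℕ} {ι : Type} [Fintype ι] (w : ι → ℝ)
    (y : ι → EuclideanSpace ℝ (Fin n)) (x : EuclideanSpace ℝ (Fin n)) : Prop where
  nonneg : ∀ i, 0 ≤ w i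
  sum_eq_one : ∑ i, w i = 1
  sum_smul_eq : ∑ i, w i • y i = x

section Envelope

variable {n : ℕ} {ι : Type} [Fintype ι]

theorem IsConvexComb.sum_mul_le {w : ι → ℝ} {y : ι → EuclideanSpace ℝ (Fin n)}
    {x : EuclideanSpace ℝ (Fin n)} (h : IsConvexComb w y x) {u : ι → ℝ} {C : ℝ}
    (hu : ∀ i, u i ≤ C) : ∑ i, w i * u i ≤ C := by
  calc ∑ i, w i * u i ≤ ∑ i, w i * C :=
        Finset.sum_le_sum fun i _ => mul_le_mul_of_nonneg_left (hu i) (h.nonneg i)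
    _ = C := by rw [← Finset.sum_mul, h.sum_eq_one, one_mul]

theorem exists_isConvexComb_of_mem_convexHull {T : Set (EuclideanSpace ℝ (Fin n))}
    {x : EuclideanSpace ℝ (Fin n)} (hx : x ∈ convexHull ℝ T) :
    ∃ (κ : Type) (_ : Fintype κ) (w : κ → ℝ) (y : κ → EuclideanSpace ℝ (Fin n)),
      IsConvexComb w y x ∧ ∀ i, y i ∈ T := by
  obtain ⟨κ, _, w, y, h0, h1, hy, hx⟩ := mem_convexHull_iff_exists_fintype.1 hx
  exact ⟨κ, _, w, y, ⟨h0, h1, hx⟩, hy⟩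

theorem convexEnvelope_le_sum {g : EuclideanSpace ℝ (Fin n) → ℝ} {m : ℝ} (hg : ∀ y, m ≤ g y)
    {w : ι → ℝ} {y : ι → EuclideanSpace ℝ (Fin n)} {x : EuclideanSpace ℝ (Fin n)}
    (h : IsConvexComb w y x) : convexEnvelope g x ≤ ∑ i, w i * g (y i) := by
  refine csSup_le ⟨m, fun _ => m, convexOn_const _ convex_univ, hg, rfl⟩ ?_
  rintro v ⟨φ, hφ, hle, rfl⟩
  calc φ x = φ (∑ i, w i • y i) := by rw [h.sum_smul_eq]
    _ ≤ ∑ i, w i • φ (y i) :=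
        hφ.map_sum_le (fun i _ => h.nonneg i) h.sum_eq_one fun _ _ => Set.mem_univ _
    _ ≤ ∑ i, w i * g (y i) :=
        Finset.sum_le_sum fun i _ => mul_le_mul_of_nonneg_left (hle _) (h.nonneg i)

/-- If every point of the graph of `g` lies on or above the convex hull of the graph of `g` over
`T`, then combinations of points of `T` suffice to compute the envelope: the lower boundary of
that hull is a convex minorant of `g`. -/
theorem exists_sum_le_convexEnvelope_add {g : EuclideanSpace ℝ (Fin n) → ℝ} {m : ℝ}
    (hg : ∀ y, m ≤ g y) {T : Set (EuclideanSpace ℝ (Fin n))}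
    (hT : ∀ y, ∃ v ≤ g y, (y, v) ∈ convexHull ℝ ((fun z => (z, g z)) '' T))
    {ε : ℝ} (hε : 0 < ε) (x : EuclideanSpace ℝ (Fin n)) :
    ∃ (κ : Type) (_ : Fintype κ) (w : κ → ℝ) (y : κ → EuclideanSpace ℝ (Fin n)),
      IsConvexComb w y x ∧ (∀ i, y i ∈ T) ∧ ∑ i, w i * g (y i) ≤ convexEnvelope g x + ε := by
  set H := convexHull ℝ ((fun z => (z, g z)) '' T) with hH
  have hconv : Convex ℝ H := convex_convexHull ℝ _
  have hlow : ∀ p ∈ H, m ≤ p.2 := by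
    have : H ⊆ {p | m ≤ p.2} := by
      refine convexHull_min ?_ (convex_halfSpace_ge (f := Prod.snd) ⟨fun _ _ => rfl, fun _ _ => rfl⟩ m)
      rintro _ ⟨z, -, rfl⟩
      exact hg z
    exact fun p hp => this hp
  have hne : ∀ y, {v : ℝ | (y, v) ∈ H}.Nonempty := fun y => (hT y).imp fun v hv => hv.2
  have hbdd : ∀ y, BddBelow {v : ℝ | (y, v) ∈ H} := fun y => ⟨m, fun v hv => hlow _ hv⟩
  let e : EuclideanSpace ℝ (Fin n) → ℝ := fun y => sInf {v : ℝ | (y, v) ∈ H}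
  have he_conv : ConvexOn ℝ Set.univ e := by
    refine ⟨convex_univ, fun y _ z _ a b ha hb hab => ?_⟩
    refine le_of_forall_pos_le_add fun δ hδ => ?_
    obtain ⟨v, hv, hvlt⟩ := Real.lt_sInf_add_pos (hne y) hδ
    obtain ⟨v', hv', hvlt'⟩ := Real.lt_sInf_add_pos (hne z) hδ
    have hmem : (a • y + b • z, a • v + b • v') ∈ H := hconv hv hv' ha hb hab
    calc e (a • y + b • z) ≤ a • v + b • v' := csInf_le (hbdd _) hmem
      _ ≤ a • (e y + δ) + b • (e z + δ) := by
          simp only [smul_eq_mul]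
          exact add_le_add (mul_le_mul_of_nonneg_left hvlt.le ha)
            (mul_le_mul_of_nonneg_left hvlt'.le hb)
      _ = a • e y + b • e z + δ := by
          simp only [smul_eq_mul]
          linear_combination δ * hab
  have he_le : ∀ y, e y ≤ g y := fun y => by
    obtain ⟨v, hv, hvH⟩ := hT y
    exact (csInf_le (hbdd y) hvH).trans hv
  have hex : e x ≤ convexEnvelope g x := by
    refine le_csSup ⟨g x, ?_⟩ ⟨e, he_conv, he_le, rfl⟩
    rintro _ ⟨h, -, hle, rfl⟩
    exact hle x
  obtain ⟨v, hv, hvlt⟩ := Real.lt_sInf_add_pos (hne x) hε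
  obtain ⟨κ, hκ, w, p, h0, h1, hp, hsum⟩ := mem_convexHull_iff_exists_fintype.1 (show _ ∈ H from hv)
  choose y hyT hyp using hp
  have hyp' : p = fun i => (y i, g (y i)) := funext fun i => (hyp i).symm
  subst hyp'
  refine ⟨κ, hκ, w, y, ⟨h0, h1, ?_⟩, hyT, ?_⟩
  · have := congrArg Prod.fst hsum
    simpa [Prod.fst_sum] using this
  · have h2 : ∑ i, w i * g (y i) = v := by
      have := congrArg Prod.snd hsum
      simpa [Prod.snd_sum] using this
    have h3 : v < e x + ε := hvlt
    linarith

/-- Points of the convex hull of `S` lie on or above the hull of the graph of `g` over `S`, once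
`g` is bounded by `C` there. -/
theorem exists_mem_convexHull_graph {g : EuclideanSpace ℝ (Fin n) → ℝ}
    {S T : Set (EuclideanSpace ℝ (Fin n))} (hST : S ⊆ T) {C : ℝ} (hC : ∀ z ∈ S, g z ≤ C)
    {y : EuclideanSpace ℝ (Fin n)} (hy : y ∈ convexHull ℝ S) :
    ∃ v ≤ C, (y, v) ∈ convexHull ℝ ((fun z => (z, g z)) '' T) := by
  obtain ⟨κ, _, w, z, h, hz⟩ := exists_isConvexComb_of_mem_convexHull hy
  refine ⟨∑ i, w i * g (z i), h.sum_mul_le fun i => hC _ (hz i), ?_⟩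
  refine mem_convexHull_of_exists_fintype w (fun i => (z i, g (z i))) h.nonneg h.sum_eq_one
    (fun i => ⟨z i, hST (hz i), rfl⟩) ?_
  ext1
  · simpa [Prod.fst_sum] using h.sum_smul_eq
  · simp [Prod.snd_sum]

/-! ### Compensated transforms through convex combinations -/

theorem IsConvexComb.sum_mul_norm_sub_sq {w : ι → ℝ} {y : ι → EuclideanSpace ℝ (Fin n)}
    {x : EuclideanSpace ℝ (Fin n)} (h : IsConvexComb w y x) :
    ∑ i, w i * ‖y i - x‖ ^ 2 = ∑ i, w i * ‖y i‖ ^ 2 - ‖x‖ ^ 2 := by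
  have h1 : ∑ i, w i * inner ℝ (y i) x = ‖x‖ ^ 2 := by
    rw [← real_inner_self_eq_norm_sq]
    nth_rewrite 2 [← h.sum_smul_eq]
    rw [sum_inner]
    simp [real_inner_smul_left]
  calc ∑ i, w i * ‖y i - x‖ ^ 2
      = ∑ i, (w i * ‖y i‖ ^ 2 - 2 * (w i * inner ℝ (y i) x) + w i * ‖x‖ ^ 2) :=
        Finset.sum_congr rfl fun i _ => by rw [norm_sub_sq_real]; ring
    _ = _ := by
        rw [Finset.sum_add_distrib, Finset.sum_sub_distrib, ← Finset.mul_sum, h1, ← Finset.sum_mul,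
          h.sum_eq_one]
        ring

theorem IsConvexComb.sum_mul_compensated {w : ι → ℝ} {y : ι → EuclideanSpace ℝ (Fin n)}
    {x : EuclideanSpace ℝ (Fin n)} (h : IsConvexComb w y x) (lam : ℝ) (u : ι → ℝ) :
    ∑ i, w i * (lam * ‖y i‖ ^ 2 + u i) - lam * ‖x‖ ^ 2
      = lam * ∑ i, w i * ‖y i - x‖ ^ 2 + ∑ i, w i * u i := by
  have : ∑ i, w i * (lam * ‖y i‖ ^ 2 + u i)
      = lam * ∑ i, w i * ‖y i‖ ^ 2 + ∑ i, w i * u i := by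
    rw [Finset.mul_sum, ← Finset.sum_add_distrib]
    exact Finset.sum_congr rfl fun i _ => by ring
  rw [this, h.sum_mul_norm_sub_sq]
  ring

theorem lowerTransform_le_sum {lam m : ℝ} (hlam : 0 < lam) {g : EuclideanSpace ℝ (Fin n) → ℝ}
    (hg : ∀ y, m ≤ g y) {w : ι → ℝ} {y : ι → EuclideanSpace ℝ (Fin n)}
    {x : EuclideanSpace ℝ (Fin n)} (h : IsConvexComb w y x) :
    lowerTransform lam g x ≤ lam * ∑ i, w i * ‖y i - x‖ ^ 2 + ∑ i, w i * g (y i) := by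
  rw [← h.sum_mul_compensated]
  refine sub_le_sub_right (convexEnvelope_le_sum (m := m) (fun y => ?_) h) _
  have := hg y
  nlinarith [mul_nonneg hlam.le (sq_nonneg ‖y‖)]

theorem upperTransform_eq_neg_lowerTransform (lam : ℝ) (g : EuclideanSpace ℝ (Fin n) → ℝ)
    (x : EuclideanSpace ℝ (Fin n)) :
    upperTransform lam g x = -lowerTransform lam (-g) x := by
  simp [upperTransform, lowerTransform, sub_eq_add_neg]

theorem sum_le_upperTransform {lam m : ℝ} (hlam : 0 < lam) {g : EuclideanSpace ℝ (Fin n) → ℝ}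
    (hg : ∀ y, g y ≤ m) {w : ι → ℝ} {y : ι → EuclideanSpace ℝ (Fin n)}
    {x : EuclideanSpace ℝ (Fin n)} (h : IsConvexComb w y x) :
    ∑ i, w i * g (y i) - lam * ∑ i, w i * ‖y i - x‖ ^ 2 ≤ upperTransform lam g x := by
  rw [upperTransform_eq_neg_lowerTransform]
  have := lowerTransform_le_sum (g := -g) (m := -m) hlam (fun y => neg_le_neg (hg y)) h
  simp only [Pi.neg_apply, mul_neg, Finset.sum_neg_distrib] at this
  linarith

theorem exists_sum_le_lowerTransform_add {lam m : ℝ} (hlam : 0 < lam)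
    {g : EuclideanSpace ℝ (Fin n) → ℝ} (hg : ∀ y, m ≤ g y) {T : Set (EuclideanSpace ℝ (Fin n))}
    (hT : ∀ y, ∃ v ≤ lam * ‖y‖ ^ 2 + g y,
      (y, v) ∈ convexHull ℝ ((fun z => (z, lam * ‖z‖ ^ 2 + g z)) '' T))
    {ε : ℝ} (hε : 0 < ε) (x : EuclideanSpace ℝ (Fin n)) :
    ∃ (κ : Type) (_ : Fintype κ) (w : κ → ℝ) (y : κ → EuclideanSpace ℝ (Fin n)),
      IsConvexComb w y x ∧ (∀ i, y i ∈ T) ∧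
        lam * ∑ i, w i * ‖y i - x‖ ^ 2 + ∑ i, w i * g (y i) ≤ lowerTransform lam g x + ε := by
  obtain ⟨κ, _, w, y, h, hy, hle⟩ := exists_sum_le_convexEnvelope_add (m := m)
    (fun y => by nlinarith [hg y, mul_nonneg hlam.le (sq_nonneg ‖y‖)]) hT hε x
  refine ⟨κ, _, w, y, h, hy, ?_⟩
  rw [← h.sum_mul_compensated, lowerTransform]
  linarith

theorem averageApprox_neg (lam M : ℝ) (S : Set (EuclideanSpace ℝ (Fin n)))
    (f : EuclideanSpace ℝ (Fin n) → ℝ) (x : EuclideanSpace ℝ (Fin n)) :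
    averageApprox lam M S (-f) x = -averageApprox lam M S f x := by
  have h : ∀ c : ℝ, -extendConst S (-f) (-c) = extendConst S f c := fun c => by
    ext y
    by_cases hy : y ∈ S <;> simp [extendConst, hy]
  have h' : extendConst S (-f) M = -extendConst S f (-M) := by
    rw [← h (-M), neg_neg, neg_neg]
  rw [averageApprox, averageApprox, upperTransform_eq_neg_lowerTransform, h,
    upperTransform_eq_neg_lowerTransform, h']
  ring

theorem extendConst_congr {S : Set (EuclideanSpace ℝ (Fin n))}
    {f g : EuclideanSpace ℝ (Fin n) → ℝ} (hfg : ∀ y ∈ S, f y = g y) (c : ℝ) :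
    extendConst S f c = extendConst S g c := by
  ext y
  by_cases hy : y ∈ S <;> simp [extendConst, hy, hfg y]

theorem averageApprox_congr {S : Set (EuclideanSpace ℝ (Fin n))}
    {f g : EuclideanSpace ℝ (Fin n) → ℝ} (hfg : ∀ y ∈ S, f y = g y) (lam M : ℝ) :
    averageApprox lam M S f = averageApprox lam M S g := by
  ext x
  simp only [averageApprox, extendConst_congr hfg]

theorem abs_extendConst_le {S : Set (EuclideanSpace ℝ (Fin n))}
    {f : EuclideanSpace ℝ (Fin n) → ℝ} {C : ℝ} (hC : ∀ y, |f y| ≤ C) (c : ℝ)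
    (y : EuclideanSpace ℝ (Fin n)) : |extendConst S f c y| ≤ max C |c| := by
  by_cases hy : y ∈ S
  · simpa [extendConst, hy] using Or.inl (hC y)
  · simp [extendConst, hy]

end Envelope

end CompensatedConvex

namespace CompensatedConvex

/-! ### The modulus of continuity and its least concave majorant -/

section Modulus

variable {w : ℝ → ℝ} {D : ℝ}

theorem leastConcaveMajorant_le (hw0 : ∀ t, 0 ≤ t → 0 ≤ w t) {g : ℝ → ℝ}
    (hg : ConcaveOn ℝ (Set.Ici 0) g) (hwg : ∀ s, 0 ≤ s → w s ≤ g s) {t : ℝ} (ht : 0 ≤ t) :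
    leastConcaveMajorant w t ≤ g t := by
  refine csInf_le ⟨0, ?_⟩ ⟨g, hg, hwg, rfl⟩
  rintro _ ⟨k, -, hk, rfl⟩
  exact (hw0 t ht).trans (hk t ht)

theorem le_leastConcaveMajorant_of_forall (hwD : ∀ t, w t ≤ D) {t c : ℝ}
    (hc : ∀ g : ℝ → ℝ, ConcaveOn ℝ (Set.Ici 0) g → (∀ s, 0 ≤ s → w s ≤ g s) → c ≤ g t) :
    c ≤ leastConcaveMajorant w t := by
  refine le_csInf ⟨D, fun _ => D, concaveOn_const _ (convex_Ici 0), fun s _ => hwD s, rfl⟩ ?_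
  rintro _ ⟨g, hg, hwg, rfl⟩
  exact hc g hg hwg

theorem le_leastConcaveMajorant (hwD : ∀ t, w t ≤ D) {t : ℝ} (ht : 0 ≤ t) :
    w t ≤ leastConcaveMajorant w t :=
  le_leastConcaveMajorant_of_forall hwD fun _ _ hwg => hwg t ht

theorem concaveOn_leastConcaveMajorant (hw0 : ∀ t, 0 ≤ t → 0 ≤ w t) (hwD : ∀ t, w t ≤ D) :
    ConcaveOn ℝ (Set.Ici 0) (leastConcaveMajorant w) := by
  refine ⟨convex_Ici 0, fun s hs t ht a b ha hb hab => ?_⟩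
  refine le_leastConcaveMajorant_of_forall hwD fun g hg hwg => ?_
  refine le_trans ?_ (hg.2 hs ht ha hb hab)
  simp only [smul_eq_mul]
  exact add_le_add (mul_le_mul_of_nonneg_left (leastConcaveMajorant_le hw0 hg hwg hs) ha)
    (mul_le_mul_of_nonneg_left (leastConcaveMajorant_le hw0 hg hwg ht) hb)

variable {ω : ℝ → ℝ}

/-- A nonnegative concave function on `[0, ∞)` is nondecreasing: a decrease would continue at
least linearly, down to negative values. -/
theorem monotone_of_concaveOn_nonneg (hω : ConcaveOn ℝ (Set.Ici 0) ω)
    (hω0 : ∀ t, 0 ≤ t → 0 ≤ ω t) {s t : ℝ} (hs : 0 ≤ s) (hst : s ≤ t) : ω s ≤ ω t := by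
  have key : ∀ μ : ℝ, 0 < μ → μ ≤ 1 → (1 - μ) * ω s ≤ ω t := fun μ hμ hμ1 => by
    have hu : 0 ≤ s + (t - s) / μ := add_nonneg hs (div_nonneg (sub_nonneg.2 hst) hμ.le)
    have h := hω.2 (Set.mem_Ici.2 hs) (Set.mem_Ici.2 hu) (sub_nonneg.2 hμ1) hμ.le (by ring)
    have he : (1 - μ) • s + μ • (s + (t - s) / μ) = t := by
      simp only [smul_eq_mul]
      field_simp
      ring
    rw [he] at h
    simp only [smul_eq_mul] at h
    linarith [mul_nonneg hμ.le (hω0 _ hu)]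
  by_contra! hlt
  have hpos : 0 < ω s := (hω0 t (hs.trans hst)).trans_lt hlt
  have := key ((ω s - ω t) / (2 * ω s)) (div_pos (by linarith) (by linarith))
    ((div_le_one (by linarith)).2 (by linarith [hω0 t (hs.trans hst)]))
  have he : (1 - (ω s - ω t) / (2 * ω s)) * ω s = (ω s + ω t) / 2 := by
    field_simp
    ring
  linarith

theorem mul_le_mul_of_concaveOn_nonneg (hω : ConcaveOn ℝ (Set.Ici 0) ω) (hω0 : 0 ≤ ω 0)
    {s t : ℝ} (hs : 0 < s) (hst : s ≤ t) : s * ω t ≤ t * ω s := by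
  have ht : 0 < t := hs.trans_le hst
  have h1 : s / t ≤ 1 := (div_le_one ht).2 hst
  have h := hω.2 (Set.mem_Ici.2 le_rfl) (Set.mem_Ici.2 ht.le) (sub_nonneg.2 h1)
    (div_pos hs ht).le (by ring)
  have he : (1 - s / t) • (0 : ℝ) + (s / t) • t = s := by
    simp only [smul_eq_mul]
    field_simp
    ring
  rw [he] at h
  simp only [smul_eq_mul] at h
  have h2 : s / t * ω t ≤ ω s := by linarith [mul_nonneg (sub_nonneg.2 h1) hω0]
  calc s * ω t = t * (s / t * ω t) := by field_simp
    _ ≤ t * ω s := mul_le_mul_of_nonneg_left h2 ht.le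

/-- Right continuity of a concave modulus, with the endpoint `0` treated by the vanishing of
`ω`. -/
theorem le_of_forall_pos_le_concave_add (hω : ConcaveOn ℝ (Set.Ici 0) ω) (hω0 : 0 ≤ ω 0)
    {c t : ℝ} (ht : 0 ≤ t) (hzero : t = 0 → ∀ s, 0 ≤ s → ω s ≤ 0)
    (h : ∀ η, 0 < η → c ≤ ω (t + η) + η) : c ≤ ω t := by
  rcases ht.eq_or_lt with rfl | ht
  · refine (le_of_forall_pos_le_add fun η hη => ?_ : c ≤ 0).trans hω0
    have := h η hη
    linarith [hzero rfl (0 + η) (by linarith)]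
  · by_contra! hlt
    set d := c - ω t with hd
    have hdpos : 0 < d := sub_pos.2 hlt
    -- `t * ω (t + η) ≤ (t + η) * ω t`, so `t * d ≤ η * (ω t + t)` for every `η > 0`
    have key : ∀ η, 0 < η → t * d ≤ η * (ω t + t) := fun η hη => by
      have h1 := mul_le_mul_of_concaveOn_nonneg hω hω0 ht (le_add_of_nonneg_right hη.le)
      have h2 := mul_le_mul_of_nonneg_left (h η hη) ht.le
      rw [hd]
      linarith
    have hq : 0 < |ω t + t| + 1 := by positivity
    have h3 := key (t * d / (2 * (|ω t + t| + 1))) (by positivity)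
    have h4 : t * d / (2 * (|ω t + t| + 1)) * (ω t + t) ≤ t * d / 2 := by
      rw [div_mul_eq_mul_div, div_le_div_iff₀ (by positivity) two_pos]
      nlinarith [le_abs_self (ω t + t), mul_pos ht hdpos]
    linarith [mul_pos ht hdpos]

variable {n : ℕ} {F : EuclideanSpace ℝ (Fin n) → ℝ} {C : ℝ}

theorem modulusOfContinuity_nonneg (F : EuclideanSpace ℝ (Fin n) → ℝ) (t : ℝ) :
    0 ≤ modulusOfContinuity F t := by
  refine Real.sSup_nonneg ?_
  rintro _ ⟨x, y, -, rfl⟩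
  exact abs_nonneg _

theorem abs_sub_le_two_mul (hC : ∀ x, |F x| ≤ C) (x y : EuclideanSpace ℝ (Fin n)) :
    |F x - F y| ≤ 2 * C := by
  have h1 := abs_le.1 (hC x)
  have h2 := abs_le.1 (hC y)
  exact abs_le.2 ⟨by linarith, by linarith⟩

theorem modulusOfContinuity_le (hC : ∀ x, |F x| ≤ C) (t : ℝ) :
    modulusOfContinuity F t ≤ 2 * C := by
  refine Real.sSup_le ?_ (by linarith [(abs_nonneg _).trans (hC 0)])
  rintro _ ⟨x, y, -, rfl⟩
  exact abs_sub_le_two_mul hC x y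

theorem abs_sub_le_modulusOfContinuity (hC : ∀ x, |F x| ≤ C) (x y : EuclideanSpace ℝ (Fin n)) :
    |F x - F y| ≤ modulusOfContinuity F ‖x - y‖ := by
  refine le_csSup ⟨2 * C, ?_⟩ ⟨x, y, le_rfl, rfl⟩
  rintro _ ⟨x, y, -, rfl⟩
  exact abs_sub_le_two_mul hC x y

theorem modulusOfContinuity_neg (F : EuclideanSpace ℝ (Fin n) → ℝ) :
    modulusOfContinuity (-F) = modulusOfContinuity F := by
  have : ∀ x y, |(-F) x - (-F) y| = |F x - F y| := fun x y => by
    rw [Pi.neg_apply, Pi.neg_apply, ← abs_neg]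
    congr 1
    ring
  ext t
  simp only [modulusOfContinuity, this]

theorem leastConcaveMajorant_modulus_le_of_lipschitz {L : ℝ} (hL : 0 ≤ L)
    (hF : ∀ x y, |F x - F y| ≤ L * ‖x - y‖) {t : ℝ} (ht : 0 ≤ t) :
    leastConcaveMajorant (modulusOfContinuity F) t ≤ L * t := by
  refine leastConcaveMajorant_le (fun t _ => modulusOfContinuity_nonneg F t)
    (g := fun t => L * t) ?_ (fun s hs => Real.sSup_le ?_ (by positivity)) ht
  · exact (LinearMap.mul ℝ ℝ L).concaveOn (convex_Ici 0)
  · rintro _ ⟨x, y, hxy, rfl⟩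
    exact (hF x y).trans (mul_le_mul_of_nonneg_left hxy hL)

end Modulus

/-! ### Second-order Taylor bound for `C^{1,1}` functions -/

/-- The error of the first-order Taylor expansion is at most `L / 2 * ‖y - x‖ ^ 2` when the
derivative is `L`-Lipschitz. -/
theorem taylor_lower_of_lipschitz_fderiv {n : ℕ} {F : EuclideanSpace ℝ (Fin n) → ℝ} {L : ℝ}
    (hF : Differentiable ℝ F) (hL : ∀ x y, ‖fderiv ℝ F x - fderiv ℝ F y‖ ≤ L * ‖x - y‖)
    (x y : EuclideanSpace ℝ (Fin n)) :
    F x + fderiv ℝ F x (y - x) - L / 2 * ‖y - x‖ ^ 2 ≤ F y := by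
  let φ : ℝ → ℝ := fun t => F (x + t • (y - x)) - t * fderiv ℝ F x (y - x)
    + L / 2 * ‖y - x‖ ^ 2 * t ^ 2
  have hd : ∀ t, HasDerivAt φ (fderiv ℝ F (x + t • (y - x)) (y - x) - fderiv ℝ F x (y - x)
      + L * ‖y - x‖ ^ 2 * t) t := fun t => by
    have h1 : HasDerivAt (fun t : ℝ => x + t • (y - x)) (y - x) t := by
      simpa using ((hasDerivAt_id t).smul_const (y - x)).const_add x
    have h2 := (hF (x + t • (y - x))).hasFDerivAt.comp_hasDerivAt t h1
    have h3 := (h2.sub ((hasDerivAt_id t).mul_const (fderiv ℝ F x (y - x)))).add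
      ((hasDerivAt_pow 2 t).const_mul (L / 2 * ‖y - x‖ ^ 2))
    refine h3.congr_deriv ?_
    norm_num
    ring
  have hmono : MonotoneOn φ (Set.Icc 0 1) := by
    refine monotoneOn_of_deriv_nonneg (convex_Icc 0 1)
      (fun t _ => (hd t).continuousAt.continuousWithinAt)
      (fun t _ => (hd t).differentiableAt.differentiableWithinAt) fun t ht => ?_
    rw [interior_Icc] at ht
    rw [(hd t).deriv, ← sub_apply]
    have h1 := (abs_le.1 ((fderiv ℝ F (x + t • (y - x)) - fderiv ℝ F x).le_opNorm (y - x))).1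
    have h2 := hL (x + t • (y - x)) x
    rw [add_sub_cancel_left, norm_smul, Real.norm_of_nonneg ht.1.le] at h2
    have h3 := mul_le_mul_of_nonneg_right h2 (norm_nonneg (y - x))
    nlinarith
  have h := hmono (Set.left_mem_Icc.2 zero_le_one) (Set.right_mem_Icc.2 zero_le_one) zero_le_one
  simp only [φ] at h
  simp only [zero_smul, add_zero, zero_mul, sub_zero, one_smul, one_mul, add_sub_cancel] at h
  norm_num at h ⊢
  linarith

end CompensatedConvex

namespace CompensatedConvex

/-! ### Geometry of the sample set -/

section Geometry

variable {n : ℕ} {Lam Om : Set (EuclideanSpace ℝ (Fin n))}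

/-- A segment leaving `Lam` meets `Lam \ Om`; it cannot pass directly from the open set `Om` to
the open complement of `Lam`. -/
theorem exists_mem_sdiff_of_notMem (hLam : IsClosed Lam) (hOm : IsOpen Om)
    (hsub : Om ⊆ Lam) {x y : EuclideanSpace ℝ (Fin n)} (hx : x ∈ Lam) (hy : y ∉ Lam) :
    ∃ θ : ℝ, 0 ≤ θ ∧ θ ≤ 1 ∧ x + θ • (y - x) ∈ Lam \ Om ∧ (x ∈ Om → 0 < θ) := by
  by_cases hxO : x ∈ Om
  swap
  · exact ⟨0, le_rfl, zero_le_one, by simpa using ⟨hx, hxO⟩, fun h => absurd h hxO⟩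
  have hmeet : ∃ z ∈ segment ℝ x y, z ∈ Lam \ Om := by
    by_contra! hno
    obtain ⟨z, -, hzO, hzL⟩ := (convex_segment (𝕜 := ℝ) x y).isPreconnected Om Lamᶜ hOm
      hLam.isOpen_compl
      (fun z hz => by
        by_cases hzO : z ∈ Om
        · exact Or.inl hzO
        · exact Or.inr fun hzL => hno z hz ⟨hzL, hzO⟩)
      ⟨x, left_mem_segment ℝ x y, hxO⟩ ⟨y, right_mem_segment ℝ x y, hy⟩
    exact hzL (hsub hzO)
  obtain ⟨z, hz, hzK⟩ := hmeet
  rw [segment_eq_image'] at hz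
  obtain ⟨θ, ⟨h0, h1⟩, rfl⟩ := hz
  refine ⟨θ, h0, h1, hzK, fun _ => h0.lt_of_ne ?_⟩
  rintro rfl
  exact hzK.2 (by simpa using hxO)

theorem mem_convexHull_sdiff (hLam : IsClosed Lam) (hbdd : Bornology.IsBounded Lam)
    (hOm : IsOpen Om) (hsub : Om ⊆ Lam) (hne : (Lam \ Om).Nonempty)
    {y : EuclideanSpace ℝ (Fin n)} (hy : y ∈ Om) : y ∈ convexHull ℝ (Lam \ Om) := by
  obtain ⟨k, hk⟩ := hne
  have hu : 0 < ‖y - k‖ := norm_pos_iff.2 (sub_ne_zero.2 fun h => hk.2 (h ▸ hy))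
  obtain ⟨C, hC⟩ := hbdd.exists_norm_le
  have hC0 : 0 ≤ C := (norm_nonneg y).trans (hC y (hsub hy))
  -- a point far out on the ray from `k` through `y`
  set t : ℝ := (C + ‖y‖ + 1) / ‖y - k‖ with ht
  have htpos : 0 < t := by positivity
  have hfar : y + t • (y - k) ∉ Lam := fun hmem => by
    have h1 := hC _ hmem
    have h2 : ‖t • (y - k)‖ = C + ‖y‖ + 1 := by
      rw [norm_smul, Real.norm_of_nonneg htpos.le, ht]
      field_simp
    have h3 := norm_sub_le (y + t • (y - k)) y
    rw [add_sub_cancel_left, h2] at h3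
    linarith
  obtain ⟨θ, h0, -, hz, -⟩ := exists_mem_sdiff_of_notMem hLam hOm hsub (hsub hy) hfar
  rw [add_sub_cancel_left, smul_smul] at hz
  have hτ : 0 ≤ θ * t := mul_nonneg h0 htpos.le
  have hcomb := (convex_convexHull ℝ (Lam \ Om)) (subset_convexHull ℝ _ hk)
    (subset_convexHull ℝ _ hz) (a := θ * t / (1 + θ * t)) (b := 1 / (1 + θ * t))
    (by positivity) (by positivity) (by field_simp; ring)
  convert hcomb using 1
  have h1 : (1 + θ * t) ≠ 0 := by positivity
  match_scalars <;> field_simp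
  ring

/-- Pulling the points of a convex combination of `x` towards `x` by factors `θ i` and dividing
the weights by `θ i` keeps the barycentre; after normalization the moments `σ i * θ i` have not
grown. -/
theorem IsConvexComb.exists_pull {ι : Type} [Fintype ι] {w θ : ι → ℝ}
    {y : ι → EuclideanSpace ℝ (Fin n)} {x : EuclideanSpace ℝ (Fin n)} (h : IsConvexComb w y x)
    (hθ0 : ∀ i, 0 < θ i) (hθ1 : ∀ i, θ i ≤ 1) :
    ∃ σ : ι → ℝ, IsConvexComb σ (fun i => x + θ i • (y i - x)) x ∧ ∀ i, σ i * θ i ≤ w i := by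
  set N := ∑ i, w i / θ i with hN
  have hN1 : 1 ≤ N := by
    rw [← h.sum_eq_one, hN]
    exact Finset.sum_le_sum fun i _ => le_div_self (h.nonneg i) (hθ0 i) (hθ1 i)
  have hN0 : 0 < N := zero_lt_one.trans_le hN1
  have hσ : ∀ i, w i / θ i / N * θ i = N⁻¹ * w i := fun i => by
    have := (hθ0 i).ne'
    field_simp
  have hsum : ∑ i, w i / θ i / N = 1 := by rw [← Finset.sum_div, ← hN, div_self hN0.ne']
  refine ⟨fun i => w i / θ i / N, ⟨fun i => div_nonneg (div_nonneg (h.nonneg i) (hθ0 i).le) hN0.le,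
    hsum, ?_⟩, fun i => ?_⟩
  · have h0 : ∑ i, w i • (y i - x) = 0 := by
      simp only [smul_sub, Finset.sum_sub_distrib, h.sum_smul_eq, ← Finset.sum_smul, h.sum_eq_one,
        one_smul, sub_self]
    simp only [smul_add, smul_smul, hσ, Finset.sum_add_distrib, ← Finset.sum_smul, hsum, one_smul]
    simp only [mul_smul, ← Finset.smul_sum, h0, smul_zero, add_zero]
  · rw [hσ]
    exact mul_le_of_le_one_left (h.nonneg i) (inv_le_one_of_one_le₀ hN1)

theorem IsConvexComb.norm_sq_le {ι : Type} [Fintype ι] {w : ι → ℝ}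
    {y : ι → EuclideanSpace ℝ (Fin n)} {x : EuclideanSpace ℝ (Fin n)} (h : IsConvexComb w y x) :
    (∑ i, w i * ‖y i - x‖) ^ 2 ≤ ∑ i, w i * ‖y i - x‖ ^ 2 := by
  simpa using (even_two.convexOn_pow (𝕜 := ℝ)).map_sum_le (t := Finset.univ)
    (p := fun i => ‖y i - x‖) (fun i _ => h.nonneg i) h.sum_eq_one fun _ _ => Set.mem_univ _

theorem IsConvexComb.sum_mul_modulus_le {ι : Type} [Fintype ι] {w : ι → ℝ}
    {y : ι → EuclideanSpace ℝ (Fin n)} {x : EuclideanSpace ℝ (Fin n)} (h : IsConvexComb w y x)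
    {ω : ℝ → ℝ} (hω : ConcaveOn ℝ (Set.Ici 0) ω) :
    ∑ i, w i * ω ‖y i - x‖ ≤ ω (∑ i, w i * ‖y i - x‖) := by
  simpa using hω.le_map_sum (t := Finset.univ) (p := fun i => ‖y i - x‖) (fun i _ => h.nonneg i)
    h.sum_eq_one fun i _ => norm_nonneg _

theorem isConvexComb_unit (x : EuclideanSpace ℝ (Fin n)) :
    IsConvexComb (fun _ : Unit => (1 : ℝ)) (fun _ => x) x :=
  ⟨fun _ => zero_le_one, by simp, by simp⟩

end Geometry

/-! ### The error bound in terms of a concave modulus -/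

section ModulusBound

variable {n : ℕ} {Lam Om S : Set (EuclideanSpace ℝ (Fin n))}
  {F : EuclideanSpace ℝ (Fin n) → ℝ} {A₀ C r lam M : ℝ} {ω : ℝ → ℝ}

theorem exists_extendConst_graph_le (hLam : IsClosed Lam) (hbdd : Bornology.IsBounded Lam)
    (hOm : IsOpen Om) (hsub : Om ⊆ Lam) (hne : (Lam \ Om).Nonempty)
    (hKS : Lam \ Om ⊆ S) (hSO : Disjoint S Om) (hlam : 0 ≤ lam)
    (hKr : ∀ z ∈ Lam \ Om, ‖z‖ ≤ r) (hFA : ∀ z ∈ Lam \ Om, F z ≤ A₀)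
    (hM : A₀ + lam * r ^ 2 ≤ M) (y : EuclideanSpace ℝ (Fin n)) :
    ∃ v ≤ lam * ‖y‖ ^ 2 + extendConst S F M y, (y, v) ∈ convexHull ℝ
      ((fun z => (z, lam * ‖z‖ ^ 2 + extendConst S F M z)) '' Omᶜ) := by
  by_cases hy : y ∈ Om
  · have hyS : y ∉ S := fun h => hSO.ne_of_mem h hy rfl
    have hC : ∀ z ∈ Lam \ Om, lam * ‖z‖ ^ 2 + extendConst S F M z ≤ A₀ + lam * r ^ 2 :=
      fun z hz => by
        have h1 := mul_le_mul_of_nonneg_left (pow_le_pow_left₀ (norm_nonneg z) (hKr z hz) 2) hlam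
        simp only [extendConst, hKS hz, if_true]
        linarith [hFA z hz]
    obtain ⟨v, hv, hmem⟩ := exists_mem_convexHull_graph (T := Omᶜ) (fun z hz => hz.2) hC
      (mem_convexHull_sdiff hLam hbdd hOm hsub hne hy)
    refine ⟨v, ?_, hmem⟩
    have := mul_nonneg hlam (sq_nonneg ‖y‖)
    simp only [extendConst, hyS, if_false]
    linarith
  · exact ⟨_, le_rfl, subset_convexHull ℝ _ ⟨y, hy, rfl⟩⟩

/-- One-sided form of the estimate, with the mean distance `s` of a near-optimal convex
combination as the argument of the modulus. -/
theorem exists_sub_averageApprox_le (hLam : IsClosed Lam) (hbdd : Bornology.IsBounded Lam)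
    (hOm : IsOpen Om) (hsub : Om ⊆ Lam) (hKS : Lam \ Om ⊆ S) (hSO : Disjoint S Om)
    (hlam : 0 < lam) (hKr : ∀ z ∈ Lam \ Om, ‖z‖ ≤ r) (hFA : ∀ z ∈ Lam \ Om, F z ≤ A₀)
    (hM : A₀ + lam * r ^ 2 ≤ M) (hM0 : A₀ ≤ M) (hFC : ∀ y, |F y| ≤ C)
    (hω : ConcaveOn ℝ (Set.Ici 0) ω) (hω0 : ∀ t, 0 ≤ t → 0 ≤ ω t)
    (hFω : ∀ y z, |F y - F z| ≤ ω ‖y - z‖) {x : EuclideanSpace ℝ (Fin n)} (hx : x ∈ Lam)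
    {ρ : ℝ} (hxρ : x ∈ convexHull ℝ (Metric.closedBall x ρ ∩ (Lam \ Om))) {ε : ℝ} (hε : 0 < ε) :
    ∃ s, 0 ≤ s ∧ lam * s ^ 2 ≤ ω s + ω ρ + lam * ρ ^ 2 + ε ∧
      2 * (F x - averageApprox lam M S F x) ≤ 2 * ω s + ε := by
  have hmono : ∀ {s t : ℝ}, 0 ≤ s → s ≤ t → ω s ≤ ω t := fun hs hst =>
    monotone_of_concaveOn_nonneg hω hω0 hs hst
  have hbdd' : ∀ c y, |extendConst S F c y| ≤ max C |c| := fun c => abs_extendConst_le hFC c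
  have hlower : ∀ y, -max C |M| ≤ extendConst S F M y := fun y => (abs_le.1 (hbdd' M y)).1
  have hupper : ∀ y, extendConst S F (-M) y ≤ max C |-M| := fun y => (abs_le.1 (hbdd' (-M) y)).2
  have hFx : ∀ z, F x - ω ‖z - x‖ ≤ F z ∧ F z ≤ F x + ω ‖z - x‖ := fun z => by
    have := abs_le.1 (hFω z x)
    exact ⟨by linarith, by linarith⟩
  have hS : ∀ z ∈ S, ∀ c, extendConst S F c z = F z := fun z hz c => by simp [extendConst, hz]
  obtain ⟨κ, _, t, p, hp, hpm⟩ := exists_isConvexComb_of_mem_convexHull hxρ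
  have hne : (Lam \ Om).Nonempty :=
    (convexHull_nonempty_iff.1 ⟨x, hxρ⟩).mono Set.inter_subset_right
  have hdist : ∀ i, ‖p i - x‖ ≤ ρ := fun i => mem_closedBall_iff_norm.1 (hpm i).1
  obtain ⟨ι, _, w, y, hy, hyO, hle⟩ := exists_sum_le_lowerTransform_add hlam hlower
    (exists_extendConst_graph_le hLam hbdd hOm hsub hne hKS hSO hlam.le hKr hFA hM) hε x
  set s := ∑ i, w i * ‖y i - x‖ with hs
  set Q := ∑ i, w i * ‖y i - x‖ ^ 2 with hQ
  have hs0 : 0 ≤ s := Finset.sum_nonneg fun i _ => mul_nonneg (hy.nonneg i) (norm_nonneg _)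
  have hQ0 : 0 ≤ Q := Finset.sum_nonneg fun i _ => mul_nonneg (hy.nonneg i) (sq_nonneg _)
  have hsQ : s ^ 2 ≤ Q := hy.norm_sq_le
  -- points outside `S` lie outside `Lam`, and are pulled back to points of `Lam \ Om`
  have hpull : ∀ i, ∃ θ : ℝ, 0 ≤ θ ∧ θ ≤ 1 ∧ x + θ • (y i - x) ∈ S ∧ (x ∈ Om → 0 < θ) ∧
      F (x + θ • (y i - x)) ≤ extendConst S F M (y i) := fun i => by
    by_cases hyS : y i ∈ S
    · exact ⟨1, zero_le_one, le_rfl, by simpa using hyS, fun _ => one_pos, by simp [hS _ hyS]⟩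
    · obtain ⟨θ, h0, h1, hz, hpos⟩ := exists_mem_sdiff_of_notMem hLam hOm hsub hx
        (fun h => hyS (hKS ⟨h, hyO i⟩) : y i ∉ Lam)
      refine ⟨θ, h0, h1, hKS hz, hpos, ?_⟩
      simp only [extendConst, hyS, if_false]
      exact (hFA _ hz).trans hM0
  choose θ hθ0 hθ1 hθS hθpos hθF using hpull
  have hnorm : ∀ i, ‖x + θ i • (y i - x) - x‖ = θ i * ‖y i - x‖ := fun i => by
    rw [add_sub_cancel_left, norm_smul, Real.norm_of_nonneg (hθ0 i)]
  have hJ : ∑ i, w i * ω ‖y i - x‖ ≤ ω s := hy.sum_mul_modulus_le hω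
  have hA : F x - ω s ≤ ∑ i, w i * extendConst S F M (y i) := by
    have h1 : ∑ i, w i * (F x - ω ‖y i - x‖) = F x - ∑ i, w i * ω ‖y i - x‖ := by
      simp only [mul_sub, Finset.sum_sub_distrib, ← Finset.sum_mul, hy.sum_eq_one, one_mul]
    have h2 : ∑ i, w i * (F x - ω ‖y i - x‖) ≤ ∑ i, w i * extendConst S F M (y i) := by
      refine Finset.sum_le_sum fun i _ => mul_le_mul_of_nonneg_left ?_ (hy.nonneg i)
      refine le_trans ?_ (hθF i)
      refine le_trans (sub_le_sub_left (hmono (norm_nonneg _) ?_) _) (hFx _).1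
      rw [hnorm]
      exact mul_le_of_le_one_left (norm_nonneg _) (hθ1 i)
    linarith
  have hB : lowerTransform lam (extendConst S F M) x ≤ lam * ρ ^ 2 + (F x + ω ρ) := by
    refine (lowerTransform_le_sum hlam hlower hp).trans (add_le_add ?_ ?_)
    · exact mul_le_mul_of_nonneg_left
        (hp.sum_mul_le fun i => pow_le_pow_left₀ (norm_nonneg _) (hdist i) 2) hlam.le
    · refine hp.sum_mul_le fun i => ?_
      rw [hS _ (hKS (hpm i).2)]
      exact (hFx _).2.trans (add_le_add_right (hmono (norm_nonneg _) (hdist i)) _)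
  have hU : F x - ω s - lam * Q ≤ upperTransform lam (extendConst S F (-M)) x := by
    by_cases hxO : x ∈ Om
    · obtain ⟨σ, hσ, hσw⟩ := hy.exists_pull (fun i => hθpos i hxO) hθ1
      refine le_trans ?_ (sum_le_upperTransform hlam hupper hσ)
      have h1 : ∑ i, σ i * ‖x + θ i • (y i - x) - x‖ ≤ s := Finset.sum_le_sum fun i _ => by
        rw [hnorm, ← mul_assoc]
        exact mul_le_mul_of_nonneg_right (hσw i) (norm_nonneg _)
      have h2 : ∑ i, σ i * ‖x + θ i • (y i - x) - x‖ ^ 2 ≤ Q := Finset.sum_le_sum fun i _ => by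
        rw [hnorm]
        have h3 := mul_le_mul_of_nonneg_right (hσw i)
          (mul_nonneg (hθ0 i) (sq_nonneg ‖y i - x‖))
        have h4 := mul_le_mul_of_nonneg_left
          (mul_le_of_le_one_left (sq_nonneg ‖y i - x‖) (hθ1 i)) (hy.nonneg i)
        calc σ i * (θ i * ‖y i - x‖) ^ 2 = σ i * θ i * (θ i * ‖y i - x‖ ^ 2) := by ring
          _ ≤ _ := h3.trans h4
      have h3 : F x - ω s ≤ ∑ i, σ i * extendConst S F (-M) (x + θ i • (y i - x)) := by
        have h4 : ∑ i, σ i * (F x - ω ‖x + θ i • (y i - x) - x‖)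
            = F x - ∑ i, σ i * ω ‖x + θ i • (y i - x) - x‖ := by
          simp only [mul_sub, Finset.sum_sub_distrib, ← Finset.sum_mul, hσ.sum_eq_one, one_mul]
        have h5 : ∑ i, σ i * (F x - ω ‖x + θ i • (y i - x) - x‖)
            ≤ ∑ i, σ i * extendConst S F (-M) (x + θ i • (y i - x)) := by
          refine Finset.sum_le_sum fun i _ => mul_le_mul_of_nonneg_left ?_ (hσ.nonneg i)
          rw [hS _ (hθS i)]
          exact (hFx _).1
        have h6 := hσ.sum_mul_modulus_le hω
        have h7 := hmono (Finset.sum_nonneg fun i _ =>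
          mul_nonneg (hσ.nonneg i) (norm_nonneg _)) h1
        linarith
      linarith [mul_le_mul_of_nonneg_left h2 hlam.le]
    · have h1 := sum_le_upperTransform hlam hupper (isConvexComb_unit x)
      simp [hS x (hKS ⟨hx, hxO⟩)] at h1
      linarith [hω0 s hs0, mul_nonneg hlam.le hQ0]
  refine ⟨s, hs0, ?_, ?_⟩
  · linarith [mul_le_mul_of_nonneg_left hsQ hlam.le]
  · rw [averageApprox]
    linarith

theorem convexDensityRadius_nonneg (K : Set (EuclideanSpace ℝ (Fin n)))
    (x : EuclideanSpace ℝ (Fin n)) : 0 ≤ convexDensityRadius K x :=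
  Real.sInf_nonneg fun _ h => h.1

theorem exists_mem_convexHull_closedBall_inter {K : Set (EuclideanSpace ℝ (Fin n))}
    (hK : Bornology.IsBounded K) {x : EuclideanSpace ℝ (Fin n)} (hx : x ∈ convexHull ℝ K)
    {η : ℝ} (hη : 0 < η) :
    ∃ ρ, convexDensityRadius K x ≤ ρ ∧ ρ < convexDensityRadius K x + η ∧
      x ∈ convexHull ℝ (Metric.closedBall x ρ ∩ K) := by
  obtain ⟨D, hD⟩ := hK.subset_closedBall x
  have hne : {ρ : ℝ | 0 ≤ ρ ∧ x ∈ convexHull ℝ (Metric.closedBall x ρ ∩ K)}.Nonempty := by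
    refine ⟨max D 0, le_max_right _ _, ?_⟩
    rwa [Set.inter_eq_self_of_subset_right
      (hD.trans (Metric.closedBall_subset_closedBall (le_max_left _ _)))]
  obtain ⟨ρ, hρ, hlt⟩ := Real.lt_sInf_add_pos hne hη
  exact ⟨ρ, csInf_le ⟨0, fun _ h => h.1⟩ hρ, hlt, hρ.2⟩

theorem convexDensityRadius_eq_zero {K : Set (EuclideanSpace ℝ (Fin n))}
    {x : EuclideanSpace ℝ (Fin n)} (hx : x ∈ K) : convexDensityRadius K x = 0 :=
  le_antisymm (csInf_le ⟨0, fun _ h => h.1⟩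
    ⟨le_rfl, subset_convexHull ℝ _ ⟨Metric.mem_closedBall_self le_rfl, hx⟩⟩)
    (convexDensityRadius_nonneg K x)

theorem le_add_of_mul_sq_le {a b s ρ ε : ℝ} (hlam : 0 < lam) (ha : 0 ≤ a) (hb : 0 ≤ b)
    (hρ : 0 ≤ ρ) (hε : 0 ≤ ε)
    (h : lam * s ^ 2 ≤ a * s + b + (a * ρ + b) + lam * ρ ^ 2 + lam * ε ^ 2) :
    s ≤ ρ + a / lam + √(2 * b / lam) + ε := by
  set α := a / lam with hα
  set β := √(2 * b / lam) with hβ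
  have hα0 : 0 ≤ α := by positivity
  have hβ0 : 0 ≤ β := Real.sqrt_nonneg _
  have ha' : a = lam * α := by rw [hα]; field_simp
  have hb' : 2 * b = lam * β ^ 2 := by
    rw [hβ, Real.sq_sqrt (by positivity)]
    field_simp
  have h1 : s ^ 2 ≤ α * s + α * ρ + β ^ 2 + ρ ^ 2 + ε ^ 2 := by
    refine le_of_mul_le_mul_left ?_ hlam
    rw [ha'] at h
    linarith
  -- completing squares: `(s - α / 2) ^ 2 ≤ (ρ + α / 2) ^ 2 + β ^ 2 + ε ^ 2`
  have h2 : s - α / 2 ≤ ρ + α / 2 + β + ε := by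
    refine abs_le_of_sq_le_sq' ?_ (by positivity) |>.2
    nlinarith [mul_nonneg hρ hβ0, mul_nonneg hρ hε, mul_nonneg hα0 hβ0, mul_nonneg hα0 hε,
      mul_nonneg hβ0 hε]
  linarith

theorem sub_averageApprox_le_modulus (hLam : IsClosed Lam) (hbdd : Bornology.IsBounded Lam)
    (hOm : IsOpen Om) (hsub : Om ⊆ Lam) (hKS : Lam \ Om ⊆ S) (hSO : Disjoint S Om)
    (hlam : 0 < lam) (hKr : ∀ z ∈ Lam \ Om, ‖z‖ ≤ r) (hFA : ∀ z ∈ Lam \ Om, F z ≤ A₀)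
    (hM : A₀ + lam * r ^ 2 ≤ M) (hM0 : A₀ ≤ M) (hFC : ∀ y, |F y| ≤ C)
    (hω : ConcaveOn ℝ (Set.Ici 0) ω) (hω0 : ∀ t, 0 ≤ t → 0 ≤ ω t)
    (hFω : ∀ y z, |F y - F z| ≤ ω ‖y - z‖) {a b : ℝ} (ha : 0 ≤ a) (hb : 0 ≤ b)
    (hωab : ∀ t, 0 ≤ t → ω t ≤ a * t + b) {x : EuclideanSpace ℝ (Fin n)} (hx : x ∈ Lam)
    (hxK : x ∈ convexHull ℝ (Lam \ Om)) :
    F x - averageApprox lam M S F x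
      ≤ ω (convexDensityRadius (Lam \ Om) x + a / lam + √(2 * b / lam)) := by
  set ρ₀ := convexDensityRadius (Lam \ Om) x with hρ₀
  have hρ₀0 : 0 ≤ ρ₀ := convexDensityRadius_nonneg _ x
  have hα0 : 0 ≤ a / lam := by positivity
  have hβ0 : 0 ≤ √(2 * b / lam) := Real.sqrt_nonneg _
  refine le_of_forall_pos_le_concave_add hω (hω0 0 le_rfl) (by positivity) (fun h0 s hs => ?_)
    fun η hη => ?_
  · have h1 : a / lam = 0 := by linarith
    have h2 : √(2 * b / lam) = 0 := by linarith
    have ha0 : a = 0 := (div_eq_zero_iff.1 h1).resolve_right hlam.ne'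
    rw [Real.sqrt_eq_zero (by positivity)] at h2
    have hb0 : 2 * b = 0 := (div_eq_zero_iff.1 h2).resolve_right hlam.ne'
    have := hωab s hs
    rw [ha0] at this
    linarith
  · obtain ⟨ρ, hρ1, hρ2, hxρ⟩ := exists_mem_convexHull_closedBall_inter
      (hbdd.subset Set.sdiff_subset) hxK (half_pos hη)
    have hε : 0 < min (2 * η) (lam * (η / 2) ^ 2) := by positivity
    obtain ⟨s, hs0, hs, hle⟩ := exists_sub_averageApprox_le hLam hbdd hOm hsub hKS hSO hlam hKr
      hFA hM hM0 hFC hω hω0 hFω hx hxρ hε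
    have hρ0 : 0 ≤ ρ := hρ₀0.trans hρ1
    have hsle : s ≤ ρ + a / lam + √(2 * b / lam) + η / 2 := by
      refine le_add_of_mul_sq_le hlam ha hb hρ0 (half_pos hη).le ?_
      linarith [hωab s hs0, hωab ρ hρ0, min_le_right (2 * η) (lam * (η / 2) ^ 2)]
    have hmono := monotone_of_concaveOn_nonneg hω hω0 hs0
      (hsle.trans (by linarith : _ ≤ ρ₀ + a / lam + √(2 * b / lam) + η))
    linarith [min_le_left (2 * η) (lam * (η / 2) ^ 2)]

end ModulusBound

end CompensatedConvex

namespace CompensatedConvex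

/-! ### The error bound for `C^{1,1}` functions -/

section Smooth

variable {n : ℕ} {K : Set (EuclideanSpace ℝ (Fin n))} {F : EuclideanSpace ℝ (Fin n) → ℝ}
  {A₀ C L c₀ r R lam M : ℝ}

/-- A `C^{1,1}` function that is constant off a ball has vanishing derivative there, so the
constant exceeds the values inside the ball by at most a multiple of `L * r ^ 2`. -/
theorem const_le_of_lipschitz_fderiv [Nontrivial (EuclideanSpace ℝ (Fin n))]
    (hF : Differentiable ℝ F) (hL : ∀ x y, ‖fderiv ℝ F x - fderiv ℝ F y‖ ≤ L * ‖x - y‖)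
    (hconst : ∀ x, x ∉ Metric.ball (0 : EuclideanSpace ℝ (Fin n)) r → F x = c₀)
    {z : EuclideanSpace ℝ (Fin n)} (hz : ‖z‖ < r) : c₀ ≤ F z + 2 * L * r ^ 2 := by
  have hr : 0 < r := (norm_nonneg z).trans_lt hz
  obtain ⟨e, he⟩ := exists_norm_eq (EuclideanSpace ℝ (Fin n)) (by positivity : 0 ≤ 2 * r)
  have hw : r < ‖z + e‖ := by
    have := norm_sub_le (z + e) z
    rw [add_sub_cancel_left, he] at this
    linarith
  have hd : fderiv ℝ F (z + e) = 0 := by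
    have hev : F =ᶠ[nhds (z + e)] fun _ => c₀ := by
      filter_upwards [(isOpen_lt continuous_const continuous_norm).mem_nhds hw] with y hy
      exact hconst y (by simpa using le_of_lt hy)
    rw [hev.fderiv_eq]
    simp
  have h := taylor_lower_of_lipschitz_fderiv hF hL (z + e) z
  have hne : z - (z + e) = -e := by abel
  rw [hd, hne, norm_neg, he, hconst (z + e) (by simpa using hw.le)] at h
  simp only [zero_apply, add_zero] at h
  linarith

/-- Points of the ball are convex combinations of points of the sphere, where the sampled
function is `c₀`; this makes the value `M` off the sample set irrelevant. -/
theorem exists_extendConst_graph_le_of_sphere [Nontrivial (EuclideanSpace ℝ (Fin n))]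
    (hR : 0 ≤ R) (hlam : 0 ≤ lam)
    (hconst : ∀ x, x ∉ Metric.ball (0 : EuclideanSpace ℝ (Fin n)) R → F x = c₀)
    (hM : c₀ + lam * R ^ 2 ≤ M) (y : EuclideanSpace ℝ (Fin n)) :
    ∃ v ≤ lam * ‖y‖ ^ 2 + extendConst (K ∪ (Metric.ball 0 R)ᶜ) F M y, (y, v) ∈ convexHull ℝ
      ((fun z => (z, lam * ‖z‖ ^ 2 + extendConst (K ∪ (Metric.ball 0 R)ᶜ) F M z)) ''
        (K ∪ (Metric.ball 0 R)ᶜ)) := by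
  by_cases hy : y ∈ K ∪ (Metric.ball 0 R)ᶜ
  · exact ⟨_, le_rfl, subset_convexHull ℝ _ ⟨y, hy, rfl⟩⟩
  · have hyR : y ∈ convexHull ℝ (Metric.sphere (0 : EuclideanSpace ℝ (Fin n)) R) := by
      rw [convexHull_sphere_eq_closedBall 0 hR]
      exact Metric.ball_subset_closedBall (not_not.1 fun h => hy (Or.inr h))
    have hsub : Metric.sphere (0 : EuclideanSpace ℝ (Fin n)) R ⊆ K ∪ (Metric.ball 0 R)ᶜ :=
      fun z hz => Or.inr (by simpa using (mem_sphere_zero_iff_norm.1 hz).ge)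
    have hC : ∀ z ∈ Metric.sphere (0 : EuclideanSpace ℝ (Fin n)) R,
        lam * ‖z‖ ^ 2 + extendConst (K ∪ (Metric.ball 0 R)ᶜ) F M z ≤ c₀ + lam * R ^ 2 :=
      fun z hz => by
        have hz' : ‖z‖ = R := mem_sphere_zero_iff_norm.1 hz
        simp only [extendConst, hsub hz, if_true, hz', hconst z (by simpa using hz'.ge)]
        linarith
    obtain ⟨v, hv, hmem⟩ := exists_mem_convexHull_graph hsub hC hyR
    refine ⟨v, ?_, hmem⟩
    have := mul_nonneg hlam (sq_nonneg ‖y‖)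
    simp only [extendConst, hy, if_false]
    linarith

/-- One-sided form of the `C^{1,1}` estimate. The first-order term of the Taylor expansion at `x`
averages out in every convex combination of `x`. With `X` the mean squared distance of a
near-optimal combination for the lower transform, twice the error is bounded both by `L * X` and
by `(lam + L / 2) * ρ ^ 2 - (lam - L / 2) * X`; the two agree at `X = ρ ^ 2`. -/
theorem sub_averageApprox_le_of_lipschitz_fderiv [Nontrivial (EuclideanSpace ℝ (Fin n))]
    (hK : Bornology.IsBounded K) (hR : 0 ≤ R) (hL0 : 0 ≤ L) (hlam : L < lam)
    (hF : Differentiable ℝ F) (hL : ∀ x y, ‖fderiv ℝ F x - fderiv ℝ F y‖ ≤ L * ‖x - y‖)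
    (hFC : ∀ y, |F y| ≤ C)
    (hconst : ∀ x, x ∉ Metric.ball (0 : EuclideanSpace ℝ (Fin n)) R → F x = c₀)
    (hM : c₀ + lam * R ^ 2 ≤ M) {x : EuclideanSpace ℝ (Fin n)} (hx : x ∈ convexHull ℝ K) :
    F x - averageApprox lam M (K ∪ (Metric.ball 0 R)ᶜ) F x
      ≤ L / 2 * convexDensityRadius K x ^ 2 := by
  set S := K ∪ (Metric.ball (0 : EuclideanSpace ℝ (Fin n)) R)ᶜ with hSdef
  have hlam0 : 0 < lam := hL0.trans_lt hlam
  have hlower : ∀ y, -max C |M| ≤ extendConst S F M y :=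
    fun y => (abs_le.1 (abs_extendConst_le hFC M y)).1
  have hupper : ∀ y, extendConst S F (-M) y ≤ max C |-M| :=
    fun y => (abs_le.1 (abs_extendConst_le hFC (-M) y)).2
  have hS : ∀ z ∈ S, ∀ c, extendConst S F c z = F z := fun z hz c => by simp [extendConst, hz]
  -- lower bound for the mean of `F` over any convex combination of `x`
  have hmean : ∀ {ι : Type} [Fintype ι] {w : ι → ℝ} {y : ι → EuclideanSpace ℝ (Fin n)},
      IsConvexComb w y x → F x - L / 2 * ∑ i, w i * ‖y i - x‖ ^ 2 ≤ ∑ i, w i * F (y i) := by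
    intro ι _ w y h
    have h0 : ∑ i, w i * fderiv ℝ F x (y i - x) = 0 := by
      have h1 : ∑ i, w i • (y i - x) = 0 := by
        simp only [smul_sub, Finset.sum_sub_distrib, h.sum_smul_eq, ← Finset.sum_smul,
          h.sum_eq_one, one_smul, sub_self]
      have h2 := congrArg (fderiv ℝ F x) h1
      simpa only [map_sum, map_smul, smul_eq_mul, map_zero] using h2
    calc F x - L / 2 * ∑ i, w i * ‖y i - x‖ ^ 2
        = ∑ i, w i * (F x + fderiv ℝ F x (y i - x) - L / 2 * ‖y i - x‖ ^ 2) := by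
          have h3 : ∀ i, w i * (L / 2 * ‖y i - x‖ ^ 2) = L / 2 * (w i * ‖y i - x‖ ^ 2) :=
            fun i => by ring
          simp only [mul_sub, mul_add, Finset.sum_sub_distrib, Finset.sum_add_distrib, h0, h3,
            ← Finset.sum_mul, ← Finset.mul_sum, h.sum_eq_one]
          ring
      _ ≤ _ := Finset.sum_le_sum fun i _ => mul_le_mul_of_nonneg_left
          (taylor_lower_of_lipschitz_fderiv hF hL x (y i)) (h.nonneg i)
  have key : ∀ ρ ε : ℝ, x ∈ convexHull ℝ (Metric.closedBall x ρ ∩ K) → 0 < ε →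
      2 * (F x - averageApprox lam M S F x) ≤ L * ρ ^ 2 + ε := by
    intro ρ ε hxρ hε
    obtain ⟨κ, _, t, p, hp, hpm⟩ := exists_isConvexComb_of_mem_convexHull hxρ
    obtain ⟨ι, _, w, y, hy, hyS, hle⟩ := exists_sum_le_lowerTransform_add hlam0 hlower
      (exists_extendConst_graph_le_of_sphere hR hlam0.le hconst hM) hε x
    have hdist : ∑ i, t i * ‖p i - x‖ ^ 2 ≤ ρ ^ 2 := hp.sum_mul_le fun i =>
      pow_le_pow_left₀ (norm_nonneg _) (mem_closedBall_iff_norm.1 (hpm i).1) 2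
    have h1 := sum_le_upperTransform hlam0 hupper hp
    have h2 := sum_le_upperTransform hlam0 hupper hy
    have h3 := hmean hp
    have h4 := hmean hy
    simp only [hS _ (Or.inl (hpm _).2)] at h1
    simp only [hS _ (hyS _)] at h2 hle
    have h5 : (lam + L / 2) * ∑ i, t i * ‖p i - x‖ ^ 2 ≤ (lam + L / 2) * ρ ^ 2 :=
      mul_le_mul_of_nonneg_left hdist (by linarith)
    rw [averageApprox]
    rcases le_total (∑ i, w i * ‖y i - x‖ ^ 2) (ρ ^ 2) with hX | hX
    · linarith [mul_le_mul_of_nonneg_left hX hL0]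
    · have h6 := mul_le_mul_of_nonneg_left hX (by linarith : 0 ≤ lam - L / 2)
      linarith
  set ρ₀ := convexDensityRadius K x with hρ₀
  have hρ₀0 : 0 ≤ ρ₀ := convexDensityRadius_nonneg K x
  refine le_of_forall_pos_le_add fun δ hδ => ?_
  -- `η` is chosen so that `L / 2 * ((ρ₀ + η) ^ 2 - ρ₀ ^ 2) ≤ δ / 2`
  set η := min 1 (δ / (L * (2 * ρ₀ + 1) + 1)) with hη
  have hden : 0 < L * (2 * ρ₀ + 1) + 1 := by positivity
  have hη0 : 0 < η := by positivity
  have hη1 : η ≤ 1 := min_le_left _ _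
  have hηδ : η * (L * (2 * ρ₀ + 1) + 1) ≤ δ := (le_div_iff₀ hden).1 (min_le_right _ _)
  obtain ⟨ρ, hρ1, hρ2, hxρ⟩ := exists_mem_convexHull_closedBall_inter hK hx hη0
  have h1 := key ρ δ hxρ hδ
  have h2 : L * ρ ^ 2 ≤ L * ρ₀ ^ 2 + δ := by
    have h3 : ρ ^ 2 ≤ ρ₀ ^ 2 + η * (2 * ρ₀ + 1) := by
      have h4 := pow_le_pow_left₀ (hρ₀0.trans hρ1) hρ2.le 2
      nlinarith
    have h5 := mul_le_mul_of_nonneg_left h3 hL0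
    nlinarith
  linarith

end Smooth

end CompensatedConvex

namespace CompensatedConvex

/-! ### Two-sided bounds -/

section TwoSided

variable {n : ℕ} {Lam Om S K : Set (EuclideanSpace ℝ (Fin n))}
  {F : EuclideanSpace ℝ (Fin n) → ℝ} {A₀ C L c₀ r R lam M : ℝ}

theorem abs_averageApprox_sub_le_modulus (hLam : IsCompact Lam) (hOm : IsOpen Om)
    (hsub : Om ⊆ Lam) (hKS : Lam \ Om ⊆ S) (hSO : Disjoint S Om) (hlam : 0 < lam)
    (hKr : ∀ z ∈ Lam \ Om, ‖z‖ ≤ r) (hFA : ∀ z ∈ Lam \ Om, |F z| ≤ A₀)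
    (hM : A₀ + lam * r ^ 2 ≤ M) (hFC : ∀ y, |F y| ≤ C) {a b : ℝ} (ha : 0 ≤ a) (hb : 0 ≤ b)
    (hab : ∀ t, 0 ≤ t → leastConcaveMajorant (modulusOfContinuity F) t ≤ a * t + b)
    {x : EuclideanSpace ℝ (Fin n)} (hx : x ∈ Lam) (hxK : x ∈ convexHull ℝ (Lam \ Om)) :
    |averageApprox lam M S F x - F x| ≤ leastConcaveMajorant (modulusOfContinuity F)
      (convexDensityRadius (Lam \ Om) x + a / lam + √(2 * b / lam)) := by
  have hw0 : ∀ t, 0 ≤ t → 0 ≤ modulusOfContinuity F t := fun t _ => modulusOfContinuity_nonneg F t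
  have hwD := modulusOfContinuity_le hFC
  have hω0 : ∀ t, 0 ≤ t → 0 ≤ leastConcaveMajorant (modulusOfContinuity F) t :=
    fun t ht => (hw0 t ht).trans (le_leastConcaveMajorant hwD ht)
  have hω := concaveOn_leastConcaveMajorant hw0 hwD
  have hFω : ∀ y z, |F y - F z| ≤ leastConcaveMajorant (modulusOfContinuity F) ‖y - z‖ :=
    fun y z => (abs_sub_le_modulusOfContinuity hFC y z).trans
      (le_leastConcaveMajorant hwD (norm_nonneg _))
  have hFω' : ∀ y z, |(-F) y - (-F) z| ≤ leastConcaveMajorant (modulusOfContinuity F) ‖y - z‖ :=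
    fun y z => by
      rw [← modulusOfContinuity_neg F]
      rw [← modulusOfContinuity_neg F] at hwD
      exact (abs_sub_le_modulusOfContinuity (C := C) (fun u => by simpa using hFC u) y z).trans
        (le_leastConcaveMajorant hwD (norm_nonneg _))
  have hM0 : A₀ ≤ M := by linarith [mul_nonneg hlam.le (sq_nonneg r)]
  have h1 := sub_averageApprox_le_modulus hLam.isClosed hLam.isBounded hOm hsub hKS hSO hlam hKr
    (fun z hz => (abs_le.1 (hFA z hz)).2) hM hM0 hFC hω hω0 hFω ha hb hab hx hxK
  have h2 := sub_averageApprox_le_modulus (F := -F) (C := C) hLam.isClosed hLam.isBounded hOm hsub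
    hKS hSO hlam hKr (fun z hz => neg_le.1 (abs_le.1 (hFA z hz)).1) hM hM0
    (fun u => by simpa using hFC u) hω hω0 hFω' ha hb hab hx hxK
  rw [averageApprox_neg, Pi.neg_apply] at h2
  exact abs_le.2 ⟨by linarith, by linarith⟩

theorem abs_averageApprox_sub_le_of_lipschitz_fderiv [Nontrivial (EuclideanSpace ℝ (Fin n))]
    (hK : Bornology.IsBounded K) (hr : 0 < r) (hR : r < R) (hKr : ∀ z ∈ K, ‖z‖ < r)
    (hFA : ∀ z ∈ K, |F z| ≤ A₀) (hL0 : 0 ≤ L) (hlam : L < lam) (hF : Differentiable ℝ F)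
    (hL : ∀ x y, ‖fderiv ℝ F x - fderiv ℝ F y‖ ≤ L * ‖x - y‖) (hFC : ∀ y, |F y| ≤ C)
    (hconst : ∀ x, x ∉ Metric.ball (0 : EuclideanSpace ℝ (Fin n)) r → F x = c₀)
    (hM : A₀ + lam * (R + r) ^ 2 ≤ M) {x : EuclideanSpace ℝ (Fin n)} (hx : x ∈ convexHull ℝ K) :
    |averageApprox lam M (K ∪ (Metric.ball 0 R)ᶜ) F x - F x|
      ≤ L / 2 * convexDensityRadius K x ^ 2 := by
  obtain ⟨z, hz⟩ := convexHull_nonempty_iff.1 ⟨x, hx⟩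
  have hball := Metric.ball_subset_ball (x := (0 : EuclideanSpace ℝ (Fin n))) hR.le
  have hconstR : ∀ x, x ∉ Metric.ball (0 : EuclideanSpace ℝ (Fin n)) R → F x = c₀ :=
    fun x hx => hconst x fun h => hx (hball h)
  -- `2 * L * r ^ 2 ≤ lam * (2 * R * r + r ^ 2)`
  have hgap : A₀ + 2 * L * r ^ 2 + lam * R ^ 2 ≤ M := by
    have h1 := mul_le_mul_of_nonneg_right hlam.le (sq_nonneg r)
    have h2 := mul_le_mul_of_nonneg_left (mul_le_mul_of_nonneg_right hR.le hr.le)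
      (hL0.trans hlam.le)
    nlinarith [mul_nonneg (hL0.trans hlam.le) (sq_nonneg r)]
  have hzA := abs_le.1 (hFA z hz)
  have hneg : ∀ y, fderiv ℝ (-F) y = -fderiv ℝ F y := fun y => fderiv_neg
  have hL' : ∀ x y, ‖fderiv ℝ (-F) x - fderiv ℝ (-F) y‖ ≤ L * ‖x - y‖ := fun x y => by
    rw [hneg, hneg, neg_sub_neg, norm_sub_rev]
    exact hL x y
  have h1 := sub_averageApprox_le_of_lipschitz_fderiv hK (hr.trans hR).le hL0 hlam hF hL hFC
    hconstR (M := M) (by linarith [const_le_of_lipschitz_fderiv hF hL hconst (hKr z hz)]) hx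
  have h2 := sub_averageApprox_le_of_lipschitz_fderiv (F := -F) (c₀ := -c₀) (C := C) (M := M) hK
    (hr.trans hR).le hL0 hlam hF.neg hL' (fun u => by simpa using hFC u)
    (fun x hx => congrArg Neg.neg (hconstR x hx)) (by
      have h3 := const_le_of_lipschitz_fderiv (F := -F) hF.neg hL'
        (fun x hx => congrArg Neg.neg (hconst x hx)) (hKr z hz)
      rw [Pi.neg_apply] at h3
      linarith) hx
  rw [averageApprox_neg, Pi.neg_apply] at h2
  exact abs_le.2 ⟨by linarith, by linarith⟩

end TwoSided

end CompensatedConvex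

/-! ### The approximation theorem -/

open CompensatedConvex in
theorem proposition5p1 {n : ℕ}
    (Lam Om K KR : Set (EuclideanSpace ℝ (Fin n)))
    (hLam_convex : Convex ℝ Lam) (hLam_compact : IsCompact Lam)
    (hOm_open : IsOpen Om) (hOm_nonempty : Om.Nonempty) (hOm_sub : Om ⊆ Lam)
    (hK : K = Lam \ Om)
    -- the image `f`, of which only the values on `Lam` matter
    (f : EuclideanSpace ℝ (Fin n) → ℝ)
    (hf_bdd : ∃ C : ℝ, ∀ x ∈ Lam, |f x| ≤ C) (hf_uc : UniformContinuousOn f Lam)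
    (A₀ : ℝ) (hA₀ : 0 < A₀) (hfA₀ : ∀ x ∈ K, |f x| ≤ A₀)
    -- the bounded uniformly continuous extension `F` of `f`, constant outside a ball
    (F : EuclideanSpace ℝ (Fin n) → ℝ)
    (hF_bdd : ∃ C : ℝ, ∀ x, |F x| ≤ C) (hF_uc : UniformContinuous F)
    (hF_ext : ∀ x ∈ Lam, F x = f x)
    (c₀ r : ℝ) (hr : 0 < r) (hK_ball : K ⊆ Metric.ball 0 r)
    (hF_const : ∀ x, x ∉ Metric.ball (0 : EuclideanSpace ℝ (Fin n)) r → F x = c₀)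
    -- the enlarged sample set and the function `fKR` sampled on it
    (R : ℝ) (hR : r < R) (hKR : KR = K ∪ (Metric.ball 0 R)ᶜ)
    (fKR : EuclideanSpace ℝ (Fin n) → ℝ)
    (hfKR_K : ∀ x ∈ K, fKR x = f x)
    (hfKR_R : ∀ x ∈ (Metric.ball (0 : EuclideanSpace ℝ (Fin n)) R)ᶜ, fKR x = c₀) :
    -- bounded and uniformly continuous case
    (∀ a b : ℝ, 0 ≤ a → 0 ≤ b →
      (∀ t, 0 ≤ t → leastConcaveMajorant (modulusOfContinuity F) t ≤ a * t + b) →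
      ∀ lam M : ℝ, 0 < lam → A₀ + lam * (R + r) ^ 2 < M →
      ∀ x ∈ convexHull ℝ K,
        |averageApprox lam M K f x - F x|
            ≤ leastConcaveMajorant (modulusOfContinuity F)
                (convexDensityRadius K x + a / lam + √(2 * b / lam)) ∧
        |averageApprox lam M KR fKR x - F x|
            ≤ leastConcaveMajorant (modulusOfContinuity F)
                (convexDensityRadius K x + a / lam + √(2 * b / lam))) ∧
    -- globally Lipschitz case
    (∀ L : ℝ, 0 < L → (∀ x y, |F x - F y| ≤ L * ‖x - y‖) →
      ∀ lam M : ℝ, 0 < lam → A₀ + lam * (R + r) ^ 2 < M →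
      ∀ x ∈ convexHull ℝ K,
        |averageApprox lam M KR fKR x - f x|
            ≤ L * convexDensityRadius K x + L ^ 2 / lam) ∧
    -- `C^{1,1}` case, with interpolation
    (∀ L : ℝ, 0 < L → Differentiable ℝ F →
      (∀ x y, ‖fderiv ℝ F x - fderiv ℝ F y‖ ≤ L * ‖x - y‖) →
      ∀ lam M : ℝ, L < lam → A₀ + lam * (R + r) ^ 2 < M →
        (∀ x ∈ convexHull ℝ K,
          |averageApprox lam M KR fKR x - F x|
            ≤ L / 4 * ((lam + L / 2) / (lam - L / 2) + 1) * convexDensityRadius K x ^ 2) ∧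
        (∀ x ∈ K, averageApprox lam M KR fKR x = f x)) := by
  subst hK hKR
  obtain ⟨C, hFC⟩ := hF_bdd
  have hclosed := hLam_compact.isClosed
  have hbdd := hLam_compact.isBounded
  have hcoLam : convexHull ℝ (Lam \ Om) ⊆ Lam := convexHull_min Set.sdiff_subset hLam_convex
  have hKnorm : ∀ z ∈ Lam \ Om, ‖z‖ < r := fun z hz => mem_ball_zero_iff.1 (hK_ball hz)
  have hFA : ∀ z ∈ Lam \ Om, |F z| ≤ A₀ := fun z hz => by
    rw [hF_ext z hz.1]
    exact hfA₀ z hz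
  have hKf : ∀ lam M, averageApprox lam M (Lam \ Om) f = averageApprox lam M (Lam \ Om) F :=
    averageApprox_congr fun z hz => (hF_ext z hz.1).symm
  have hball := Metric.ball_subset_ball (x := (0 : EuclideanSpace ℝ (Fin n))) hR.le
  have hKRf : ∀ lam M, averageApprox lam M (Lam \ Om ∪ (Metric.ball 0 R)ᶜ) fKR
      = averageApprox lam M (Lam \ Om ∪ (Metric.ball 0 R)ᶜ) F := by
    refine averageApprox_congr ?_
    rintro z (hz | hz)
    · rw [hfKR_K z hz, hF_ext z hz.1]
    · rw [hfKR_R z hz, hF_const z fun h => hz (hball h)]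
  have hdisj : ∀ x ∈ convexHull ℝ (Lam \ Om), Disjoint (Lam \ Om ∪ (Metric.ball 0 R)ᶜ) Om := by
    refine fun x hx => Set.disjoint_left.2 ?_
    rintro z (hz | hz) hzO
    · exact hz.2 hzO
    · have hne : (Lam \ Om).Nonempty := convexHull_nonempty_iff.1 ⟨x, hx⟩
      exact hz (hball (convexHull_min hK_ball (convex_ball 0 r)
        (mem_convexHull_sdiff hclosed hbdd hOm_open hOm_sub hne hzO)))
  have hMr : ∀ {lam M : ℝ}, 0 < lam → A₀ + lam * (R + r) ^ 2 < M → A₀ + lam * r ^ 2 ≤ M :=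
    fun {lam M} hlam hM => by
      have h1 : r ^ 2 ≤ (R + r) ^ 2 := pow_le_pow_left₀ hr.le (by linarith) 2
      linarith [mul_le_mul_of_nonneg_left h1 hlam.le]
  have hi : ∀ a b : ℝ, 0 ≤ a → 0 ≤ b →
      (∀ t, 0 ≤ t → leastConcaveMajorant (modulusOfContinuity F) t ≤ a * t + b) →
      ∀ lam M : ℝ, 0 < lam → A₀ + lam * (R + r) ^ 2 < M →
      ∀ x ∈ convexHull ℝ (Lam \ Om),
        |averageApprox lam M (Lam \ Om) f x - F x|
            ≤ leastConcaveMajorant (modulusOfContinuity F)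
                (convexDensityRadius (Lam \ Om) x + a / lam + √(2 * b / lam)) ∧
        |averageApprox lam M (Lam \ Om ∪ (Metric.ball 0 R)ᶜ) fKR x - F x|
            ≤ leastConcaveMajorant (modulusOfContinuity F)
                (convexDensityRadius (Lam \ Om) x + a / lam + √(2 * b / lam)) := by
    intro a b ha hb hab lam M hlam hM x hx
    rw [hKf, hKRf]
    exact ⟨abs_averageApprox_sub_le_modulus hLam_compact hOm_open hOm_sub subset_rfl
        Set.disjoint_sdiff_left hlam (fun z hz => (hKnorm z hz).le) hFA (hMr hlam hM) hFC ha hb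
        hab (hcoLam hx) hx,
      abs_averageApprox_sub_le_modulus hLam_compact hOm_open hOm_sub Set.subset_union_left
        (hdisj x hx) hlam (fun z hz => (hKnorm z hz).le) hFA (hMr hlam hM) hFC ha hb hab
        (hcoLam hx) hx⟩
  refine ⟨hi, fun L hL hLip lam M hlam hM x hx => ?_, fun L hL hdiff hfd lam M hlam hM => ?_⟩
  · have hlip : ∀ t, 0 ≤ t → leastConcaveMajorant (modulusOfContinuity F) t ≤ L * t :=
      fun t ht => leastConcaveMajorant_modulus_le_of_lipschitz hL.le hLip ht
    have h := (hi L 0 hL.le le_rfl (fun t ht => by simpa using hlip t ht) lam M hlam hM x hx).2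
    have hρ := convexDensityRadius_nonneg (Lam \ Om) x
    rw [hF_ext x (hcoLam hx)] at h
    refine (h.trans (hlip _ (by positivity))).trans_eq ?_
    simp only [mul_zero, zero_div, Real.sqrt_zero, add_zero]
    ring
  · have hsq : ∀ x ∈ convexHull ℝ (Lam \ Om),
        |averageApprox lam M (Lam \ Om ∪ (Metric.ball 0 R)ᶜ) fKR x - F x|
          ≤ L / 2 * convexDensityRadius (Lam \ Om) x ^ 2 := fun x hx => by
      obtain ⟨k, hk⟩ := convexHull_nonempty_iff.1 ⟨x, hx⟩
      obtain ⟨o, ho⟩ := hOm_nonempty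
      have : Nontrivial (EuclideanSpace ℝ (Fin n)) := ⟨k, o, fun h => hk.2 (h ▸ ho)⟩
      rw [hKRf]
      exact abs_averageApprox_sub_le_of_lipschitz_fderiv (hbdd.subset Set.sdiff_subset) hr hR
        hKnorm hFA hL.le hlam hdiff hfd hFC hF_const hM.le hx
    refine ⟨fun x hx => (hsq x hx).trans ?_, fun x hx => ?_⟩
    · have h1 : 1 ≤ (lam + L / 2) / (lam - L / 2) := (one_le_div (by linarith)).2 (by linarith)
      exact mul_le_mul_of_nonneg_right (by nlinarith) (sq_nonneg _)
    · have h := hsq x (subset_convexHull ℝ _ hx)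
      rw [convexDensityRadius_eq_zero hx, hF_ext x hx.1] at h
      norm_num at h
      exact sub_eq_zero.1 h
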